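/- Let $k$ be an arbitrary field of characteristic $p>0$, let $\mathcal G$ be an affine algebraic group over $k$ (an affine group scheme of finite type over $k$), let $r\ge 1$, and let $G=\mathcal G_{(r)}$ be the $r$-th Frobenius kernel of $\mathcal G$. Let $M$ be a finite dimensional rational $\mathcal G$-module, regarded as a $G$-module by restriction, and let $1\le j<p$. Notation. Let $\mathbb G_{a(r)}$ be the $r$-th Frobenius kernel of the additive group, so that $k[\mathbb G_{a(r)}]=k[T]/T^{p^r}$, and let $u_{r-1}\in k\mathbb G_{a(r)}=k[\mathbb G_{a(r)}]^{*}$ be the functional which takes a function to its coefficient of $T^{p^{r-1}}$. Let $V(G)$ be the affine $k$-scheme which represents the functor $A\mapsto \operatorname{Hom}_{\mathrm{gr.sch}/A}(\mathbb G_{a(r),A},G_A)$ on commutative $k$-algebras. A point $v\in V(G)$ with residue field $k(v)$ corresponds to a one-parameter subgroup $\mu_v:\mathbb G_{a(r),k(v)}\to G_{k(v)}$; let $\theta_v=\mu_{v*}(u_{r-1})\in k(v)G$, which acts on $M_{k(v)}=k(v)\otimes_k M$. Let $0\in V(G)$ be the point of the trivial one-parameter subgroup over $k$, and put $$V^j(G)_M=\{v\in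 V(G)\ :\ \operatorname{rk}(\theta_v^j,M_{k(v)})<\operatorname{rk}(\theta_w^j,M_{k(w)})\text{ for some } w\in V(G)\}\cup\{0\}.$$ Then $V^j(G)_M$ is a Zariski closed subset of $V(G)$, and it is stable under the action of $\mathcal G$ on $V(G)$ induced by the conjugation action of $\mathcal G$ on $G$: for every field extension $K/k$, every $g\in\mathcal G(K)$ and every one-parameter subgroup $\mu:\mathbb G_{a(r),K}\to G_K$ whose underlying point of $V(G)$ lies in $V^j(G)_M$, the underlying point of $\gamma_g\circ\mu$ also lies in $V^j(G)_M$, where $\gamma_g:G_K\to G_K$, $h\mapsto ghg^{-1}$. -/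

import Mathlib

open Coalgebra Bialgebra
open scoped TensorProduct Polynomial

noncomputable section

namespace OneParameter

/-! ### Frobenius kernels of affine group schemes -/

section Frobenius

variable (k : Type*) [Field k] (p r : ℕ) (H : Type*) [CommRing H] [HopfAlgebra k H]

/-- The ideal of the kernel of the `r`-th power of Frobenius on the affine group scheme `Spec H`:
it is generated by the `p ^ r`-th powers of the elements of the augmentation ideal. -/
def frobeniusIdeal : Ideal H :=
  Ideal.span {x | ∃ f : H, counit (R := k) f = 0 ∧ x = f ^ p ^ r}

variable {k H}

theorem pow_charP_add [Fact p.Prime] [CharP k p] (R : Type*) [CommRing R] [Algebra k R] (x y : R) :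
    (x + y) ^ p ^ r = x ^ p ^ r + y ^ p ^ r := by
  rcases subsingleton_or_nontrivial R with h | h
  · exact Subsingleton.elim _ _
  · have : CharP R p := charP_of_injective_algebraMap (algebraMap k R).injective p
    have : ExpChar R p := ExpChar.prime Fact.out
    exact add_pow_expChar_pow x y p r

theorem mk_pow [Fact p.Prime] [CharP k p] (f : H) :
    (Ideal.Quotient.mkₐ k (frobeniusIdeal k p r H) f) ^ p ^ r
      = algebraMap k _ (counit (R := k) f ^ p ^ r) := by
  have h : (f - algebraMap k H (counit (R := k) f)) ^ p ^ r ∈ frobeniusIdeal k p r H :=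
    Ideal.subset_span ⟨_, by simp, rfl⟩
  have e : f ^ p ^ r = (f - algebraMap k H (counit (R := k) f)) ^ p ^ r
      + (algebraMap k H (counit (R := k) f)) ^ p ^ r := by
    rw [← pow_charP_add (k := k)]; simp
  rw [← map_pow, e, map_add]
  have h0 : Ideal.Quotient.mkₐ k (frobeniusIdeal k p r H)
      ((f - algebraMap k H (counit (R := k) f)) ^ p ^ r) = 0 := by
    simpa using Ideal.Quotient.eq_zero_iff_mem.mpr h
  rw [h0, zero_add, ← map_pow, AlgHom.commutes]

/-- `p ^ r`-th powers of functions on the base change of the Frobenius kernel. -/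
theorem map_mk_pow [Fact p.Prime] [CharP k p] (A : Type*) [CommRing A] [Algebra k A]
    (z : A ⊗[k] H) :
    (Algebra.TensorProduct.map (AlgHom.id A A)
        (Ideal.Quotient.mkₐ k (frobeniusIdeal k p r H)) z) ^ p ^ r
      = algebraMap A _ (counit (R := A) z ^ p ^ r) := by
  induction z with
  | zero => simp [(Nat.Prime.pos Fact.out : 0 < p).ne']
  | tmul a f =>
    rw [Algebra.TensorProduct.map_tmul, Algebra.TensorProduct.tmul_pow, mk_pow]
    simp [Algebra.algebraMap_eq_smul_one, TensorProduct.tmul_smul, TensorProduct.smul_tmul',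
      Algebra.TensorProduct.one_def, smul_pow]
  | add x y hx hy =>
    rw [map_add, pow_charP_add (k := k), hx, hy, ← map_add, map_add (counit (R := A)),
      pow_charP_add (k := k)]

theorem comul_mk_pow [Fact p.Prime] [CharP k p] (z : H ⊗[k] H) :
    (Algebra.TensorProduct.map (Ideal.Quotient.mkₐ k (frobeniusIdeal k p r H))
        (Ideal.Quotient.mkₐ k (frobeniusIdeal k p r H)) z) ^ p ^ r
      = algebraMap k _ (counit (R := k) z ^ p ^ r) := by
  induction z with
  | zero => simp [(Nat.Prime.pos Fact.out : 0 < p).ne']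
  | tmul a f =>
    rw [Algebra.TensorProduct.map_tmul, Algebra.TensorProduct.tmul_pow, mk_pow, mk_pow]
    simp [Algebra.algebraMap_eq_smul_one, TensorProduct.tmul_smul, mul_pow, TensorProduct.smul_tmul',
      Algebra.TensorProduct.one_def, smul_smul]
  | add x y hx hy =>
    rw [map_add, pow_charP_add (k := k), hx, hy, ← map_add, map_add (counit (R := k)),
      pow_charP_add (k := k)]

theorem frobeniusIdeal_le_ker {R : Type*} [CommRing R] [Algebra k R] (φ : H →ₐ[k] R)
    (h : ∀ f : H, counit (R := k) f = 0 → φ f ^ p ^ r = 0) {x : H}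
    (hx : x ∈ frobeniusIdeal k p r H) : φ x = 0 := by
  have : frobeniusIdeal k p r H ≤ RingHom.ker φ := by
    refine Ideal.span_le.mpr ?_
    rintro _ ⟨f, hf, rfl⟩
    exact (map_pow φ f _).trans (h f hf)
  exact this hx

instance [hp : Fact p.Prime] [CharP k p] : (frobeniusIdeal k p r H).IsHopfIdeal k where
  counit_eq_zero x hx := frobeniusIdeal_le_ker p r (counitAlgHom k H)
    (fun f hf => by
      simp [hf, hp.out.pos.ne']) hx
  map_mkQ_comul_eq_zero x hx := by
    refine frobeniusIdeal_le_ker p r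
      ((Algebra.TensorProduct.map (Ideal.Quotient.mkₐ k (frobeniusIdeal k p r H))
        (Ideal.Quotient.mkₐ k (frobeniusIdeal k p r H))).comp (comulAlgHom k H))
      (fun f hf => ?_) hx
    have hc : counit (R := k) (comul (R := k) f) = counit (R := k) f := by
      have h1 : (counitAlgHom k (H ⊗[k] H)).comp (comulAlgHom k H) = counitAlgHom k H := by
        apply AlgHom.ext
        intro a
        have h2 : ∀ z : H ⊗[k] H, counit (R := k) z
            = counit (R := k) ((counit (R := k) (A := H)).rTensor H z) := by
          intro z
          induction z with
          | zero => simp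
          | tmul a b => simp [mul_comm]
          | add x y hx hy => simp only [map_add, hx, hy]
        simp [h2]
      exact congrArg (fun φ => φ f) h1
    rw [AlgHom.comp_apply, Bialgebra.comulAlgHom_apply, comul_mk_pow, hc, hf]
    simp [hp.out.pos.ne']
  antipode_mem x hx := by
    have := frobeniusIdeal_le_ker p r
      ((Ideal.Quotient.mkₐ k (frobeniusIdeal k p r H)).comp (HopfAlgebra.antipodeAlgHom k H))
      (fun f hf => by
        rw [AlgHom.comp_apply, mk_pow]
        have : counit (R := k) (HopfAlgebra.antipodeAlgHom k H f) = 0 := by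
          rw [← hf]; exact HopfAlgebra.counit_antipode f
        rw [this, zero_pow (pow_ne_zero _ hp.out.ne_zero), map_zero]) hx
    exact Ideal.Quotient.eq_zero_iff_mem.mp this

variable (k H)

/-- The coordinate algebra of the `r`-th Frobenius kernel of the affine group scheme `Spec H`. -/
abbrev FrobeniusKernel : Type _ := H ⧸ frobeniusIdeal k p r H

end Frobenius


/-! ### The additive group and its Frobenius kernels -/

section Additive

variable (k : Type*) [Field k]

/-- The additive group: `k[T]` with `T` primitive. -/
instance instBialgebraPolynomial : Bialgebra k k[X] :=
  .ofAlgHom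
    (Polynomial.aeval (Polynomial.X ⊗ₜ[k] (1 : k[X]) + (1 : k[X]) ⊗ₜ[k] Polynomial.X))
    (Polynomial.aeval (0 : k))
    (by
      ext
      simp [Algebra.TensorProduct.one_def, TensorProduct.add_tmul, TensorProduct.tmul_add]
      abel)
    (by ext; simp)
    (by ext; simp)

theorem comul_X : comul (R := k) (Polynomial.X : k[X])
    = Polynomial.X ⊗ₜ[k] (1 : k[X]) + (1 : k[X]) ⊗ₜ[k] Polynomial.X :=
  Polynomial.aeval_X _

theorem counit_poly (f : k[X]) : counit (R := k) f = f.eval 0 :=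
  (Polynomial.coe_aeval_eq_eval (0 : k) ▸ rfl)

instance instHopfAlgebraPolynomial : HopfAlgebra k k[X] :=
  .ofAlgHom (Polynomial.aeval (-Polynomial.X))
    (by
      refine Polynomial.algHom_ext ?_
      rw [AlgHom.comp_apply, AlgHom.comp_apply, Bialgebra.comulAlgHom_apply, comul_X, map_add]
      refine (congrArg₂ (· + ·) (Algebra.TensorProduct.lift_tmul ..)
        (Algebra.TensorProduct.lift_tmul ..)).trans ?_
      simp [counit_poly])
    (by
      refine Polynomial.algHom_ext ?_
      rw [AlgHom.comp_apply, AlgHom.comp_apply, Bialgebra.comulAlgHom_apply, comul_X, map_add]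
      refine (congrArg₂ (· + ·) (Algebra.TensorProduct.lift_tmul ..)
        (Algebra.TensorProduct.lift_tmul ..)).trans ?_
      simp [counit_poly])

variable (p r : ℕ)

/-- The coordinate algebra `k[T] / T ^ (p ^ r)` of the `r`-th Frobenius kernel of the additive
group. -/
abbrev AddKernel : Type _ := FrobeniusKernel k p r k[X]

theorem frobeniusIdeal_polynomial :
    frobeniusIdeal k p r k[X] = Ideal.span {(Polynomial.X : k[X]) ^ p ^ r} := by
  apply le_antisymm
  · refine Ideal.span_le.mpr ?_
    rintro _ ⟨f, hf, rfl⟩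
    rw [counit_poly] at hf
    exact Ideal.mem_span_singleton.mpr (pow_dvd_pow_of_dvd
      (Polynomial.X_dvd_iff.mpr (by rwa [Polynomial.coeff_zero_eq_eval_zero])) _)
  · refine Ideal.span_le.mpr ?_
    rintro _ rfl
    exact Ideal.subset_span ⟨Polynomial.X, by simp [counit_poly], rfl⟩

/-- The coefficient of `T ^ m` of an element of `k[T] / T ^ (p ^ r)`
(taken in the representative of degree `< p ^ r`). -/
def addCoeff (m : ℕ) : AddKernel k p r →ₗ[k] k :=
  ((Polynomial.lcoeff k m) ∘ₗ
    (((frobeniusIdeal k p r k[X]).restrictScalars k).liftQ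
      (Polynomial.modByMonicHom ((Polynomial.X : k[X]) ^ p ^ r)) (fun _ hf =>
        (Polynomial.mem_ker_modByMonic (Polynomial.monic_X_pow _)).mpr
          (Ideal.mem_span_singleton.mp (frobeniusIdeal_polynomial k p r ▸ hf))))) ∘ₗ
    (Submodule.Quotient.restrictScalarsEquiv k (frobeniusIdeal k p r k[X])).symm.toLinearMap

theorem addCoeff_mk (m : ℕ) (f : k[X]) :
    addCoeff k p r m (Ideal.Quotient.mk _ f) = (f %ₘ (Polynomial.X ^ p ^ r)).coeff m := rfl

/-- The function `T` on the Frobenius kernel of the additive group. -/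
def addT : AddKernel k p r := Ideal.Quotient.mk _ Polynomial.X

theorem addCoeff_addT_pow (m i : ℕ) (hi : i < p ^ r) :
    addCoeff k p r m (addT k p r ^ i) = if m = i then 1 else 0 := by
  have hm := Polynomial.monic_X_pow (R := k) (p ^ r)
  rw [addT, ← map_pow, addCoeff_mk, (Polynomial.modByMonic_eq_self_iff hm).mpr,
    Polynomial.coeff_X_pow]
  rw [Polynomial.degree_X_pow, Polynomial.degree_X_pow]
  exact_mod_cast hi

theorem sum_addCoeff (x : AddKernel k p r) :
    ∑ i : Fin (p ^ r), addCoeff k p r i x • addT k p r ^ (i : ℕ) = x := by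
  obtain ⟨f, rfl⟩ := Ideal.Quotient.mk_surjective x
  have hm := Polynomial.monic_X_pow (R := k) (p ^ r)
  have h1 : (Ideal.Quotient.mk (frobeniusIdeal k p r k[X])) f
      = Ideal.Quotient.mk _ (f %ₘ (Polynomial.X ^ p ^ r)) := by
    rw [Ideal.Quotient.eq, frobeniusIdeal_polynomial, Ideal.mem_span_singleton]
    exact ⟨f /ₘ (Polynomial.X ^ p ^ r), by
      rw [sub_eq_iff_eq_add]
      conv_lhs => rw [← Polynomial.modByMonic_add_div f (Polynomial.X ^ p ^ r)]
      ring⟩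
  have h2 : (f %ₘ (Polynomial.X ^ p ^ r)).natDegree < p ^ r ∨ p ^ r = 0 := by
    rcases Nat.eq_zero_or_pos (p ^ r) with h | h
    · exact Or.inr h
    · left
      have := Polynomial.natDegree_modByMonic_lt f hm (by
        intro h'
        have := congrArg Polynomial.natDegree h'
        rw [Polynomial.natDegree_X_pow, Polynomial.natDegree_one] at this
        exact h.ne' this)
      simpa using this
  rw [h1]
  rcases h2 with h2 | h2
  · conv_rhs => rw [Polynomial.as_sum_range' _ _ h2, map_sum]
    rw [Finset.sum_range]
    refine Finset.sum_congr rfl fun i _ => ?_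
    rw [addCoeff_mk, (Polynomial.modByMonic_eq_self_iff hm).mpr (Polynomial.degree_modByMonic_lt f hm),
      ← Polynomial.smul_X_eq_monomial]
    rfl
  · have : f %ₘ (Polynomial.X ^ p ^ r) = 0 := by simp [h2]
    rw [this]; simp
end Additive

/-! ### Group scheme homomorphisms over a base, in terms of `k`-linear maps -/

section Bridge

variable {k : Type*} [Field k] {B C : Type*} [CommRing B] [Bialgebra k B] [CommRing C]
  [Bialgebra k C] {A A' : Type*} [CommRing A] [Algebra k A] [CommRing A'] [Algebra k A']

/-- For `g : B → A ⊗ C`, the map `B → A ⊗ (C ⊗ C)` which sends `f` to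
`∑ g(f₁)(s) * g(f₂)(t)`, where `Δ f = ∑ f₁ ⊗ f₂` and `s`, `t` denote the two variables in
`Spec C`. -/
def pairing (g : B →ₗ[k] A ⊗[k] C) : B →ₗ[k] A ⊗[k] (C ⊗[k] C) :=
  LinearMap.mul' k (A ⊗[k] (C ⊗[k] C)) ∘ₗ
    TensorProduct.map
      ((Algebra.TensorProduct.includeLeft : C →ₐ[k] C ⊗[k] C).toLinearMap.lTensor A ∘ₗ g)
      ((Algebra.TensorProduct.includeRight : C →ₐ[k] C ⊗[k] C).toLinearMap.lTensor A ∘ₗ g) ∘ₗ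
    comul

/-- Apply a linear functional on `N` to the second factor of `A ⊗ N`. -/
def coef {N : Type*} [AddCommGroup N] [Module k N] (ψ : N →ₗ[k] k) : A ⊗[k] N →ₗ[A] A :=
  (TensorProduct.AlgebraTensorModule.rid k A A).toLinearMap ∘ₗ ψ.baseChange A

/-- `f ↦ g(f)(0) - f(0)`: the failure of `g` to respect the unit element. -/
def unitDefect (g : B →ₗ[k] A ⊗[k] C) (f : B) : A :=
  coef (counit (R := k) (A := C)) (g f) - algebraMap k A (counit (R := k) f)

/-- `f ↦ g(f)(s + t) - ∑ g(f₁)(s) * g(f₂)(t)`: the failure of `g` to respect the group law. -/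
def mulDefect (g : B →ₗ[k] A ⊗[k] C) (f : B) : A ⊗[k] (C ⊗[k] C) :=
  (comul (R := k) (A := C)).lTensor A (g f) - pairing g f

/-- The linear map `g : B → A ⊗ C` is an algebra map, and the morphism of schemes
`Spec (A ⊗ C) → Spec (A ⊗ B)` over `A` which it defines is a homomorphism of group schemes. -/
structure IsGroupHom (g : B →ₗ[k] A ⊗[k] C) : Prop where
  map_one : g 1 = 1
  map_mul : ∀ f f', g (f * f') = g f * g f'
  unit : ∀ f, unitDefect g f = 0
  mul : ∀ f, mulDefect g f = 0

theorem coef_tmul {N : Type*} [AddCommGroup N] [Module k N] (ψ : N →ₗ[k] k) (a : A) (n : N) :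
    coef ψ (a ⊗ₜ[k] n) = ψ n • a := by simp [coef]

theorem coef_rTensor {N : Type*} [AddCommGroup N] [Module k N] (φ : A →ₐ[k] A') (ψ : N →ₗ[k] k)
    (z : A ⊗[k] N) : coef ψ (φ.toLinearMap.rTensor N z) = φ (coef ψ z) := by
  induction z with
  | zero => simp
  | tmul a n => simp [coef_tmul]
  | add x y hx hy => simp only [map_add, hx, hy]

theorem eq_zero_of_coef {N : Type*} [AddCommGroup N] [Module k N] (z : A ⊗[k] N)
    (h : ∀ ψ : N →ₗ[k] k, coef ψ z = 0) : z = 0 := by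
  let b := Module.Basis.ofVectorSpace k N
  let b' := Algebra.TensorProduct.basis A b
  have key : ∀ (w : A ⊗[k] N) (i), b'.repr w i = coef (b.coord i) w := by
    intro w i
    induction w with
    | zero => simp
    | tmul a n => simp [b', coef_tmul, Algebra.TensorProduct.basis_repr_tmul, Algebra.smul_def,
        mul_comm]
    | add x y hx hy => rw [map_add, map_add, Finsupp.add_apply, hx, hy]
  refine b'.ext_elem fun i => ?_
  rw [key, h, map_zero, Finsupp.zero_apply]

theorem rTensor_mul (φ : A →ₐ[k] A') {D : Type*} [CommRing D] [Algebra k D] (x y : A ⊗[k] D) :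
    φ.toLinearMap.rTensor D (x * y) = φ.toLinearMap.rTensor D x * φ.toLinearMap.rTensor D y :=
  map_mul (Algebra.TensorProduct.map φ (AlgHom.id k D)) x y

theorem lTensor_rTensor (φ : A →ₐ[k] A') {D E : Type*} [AddCommGroup D] [Module k D]
    [AddCommGroup E] [Module k E] (l : D →ₗ[k] E) (x : A ⊗[k] D) :
    l.lTensor A' (φ.toLinearMap.rTensor D x) = φ.toLinearMap.rTensor E (l.lTensor A x) := by
  rw [← LinearMap.comp_apply, ← LinearMap.comp_apply, LinearMap.lTensor_comp_rTensor,
    LinearMap.rTensor_comp_lTensor]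

theorem pairing_rTensor (φ : A →ₐ[k] A') (g : B →ₗ[k] A ⊗[k] C) (f : B) :
    pairing (φ.toLinearMap.rTensor C ∘ₗ g) f = φ.toLinearMap.rTensor _ (pairing g f) := by
  simp only [pairing, LinearMap.comp_apply]
  generalize (comul (R := k) f) = z
  induction z with
  | zero => simp
  | tmul x y =>
    simp only [TensorProduct.map_tmul, LinearMap.comp_apply, LinearMap.mul'_apply, rTensor_mul,
      lTensor_rTensor]
  | add x y hx hy => simp only [map_add, hx, hy]

theorem unitDefect_rTensor (φ : A →ₐ[k] A') (g : B →ₗ[k] A ⊗[k] C) (f : B) :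
    unitDefect (φ.toLinearMap.rTensor C ∘ₗ g) f = φ (unitDefect g f) := by
  simp [unitDefect, coef_rTensor]

theorem mulDefect_rTensor (φ : A →ₐ[k] A') (g : B →ₗ[k] A ⊗[k] C) (f : B) :
    mulDefect (φ.toLinearMap.rTensor C ∘ₗ g) f = φ.toLinearMap.rTensor _ (mulDefect g f) := by
  simp only [mulDefect, pairing_rTensor, LinearMap.comp_apply, lTensor_rTensor, map_sub]

variable (k A C) in
/-- Identify functions on `Spec C × Spec C` over `A`. -/
def prodMap : A ⊗[k] (C ⊗[k] C) →ₐ[A] (A ⊗[k] C) ⊗[A] (A ⊗[k] C) :=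
  Algebra.TensorProduct.lift (Algebra.ofId A _)
    (Algebra.TensorProduct.lift
      (((Algebra.TensorProduct.includeLeft :
        A ⊗[k] C →ₐ[A] (A ⊗[k] C) ⊗[A] (A ⊗[k] C)).restrictScalars k).comp
          Algebra.TensorProduct.includeRight)
      (((Algebra.TensorProduct.includeRight :
        A ⊗[k] C →ₐ[A] (A ⊗[k] C) ⊗[A] (A ⊗[k] C)).restrictScalars k).comp
          Algebra.TensorProduct.includeRight) (fun _ _ => Commute.all _ _))
    (fun _ _ => Commute.all _ _)

theorem prodMap_tmul (a : A) (c c' : C) :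
    prodMap k C A (a ⊗ₜ[k] (c ⊗ₜ[k] c')) = (a ⊗ₜ[k] c) ⊗ₜ[A] ((1 : A) ⊗ₜ[k] c') := by
  simp only [prodMap, Algebra.TensorProduct.lift_tmul, AlgHom.comp_apply,
    AlgHom.restrictScalars_apply, Algebra.TensorProduct.includeLeft_apply,
    Algebra.TensorProduct.includeRight_apply, Algebra.ofId_apply,
    Algebra.TensorProduct.algebraMap_apply, Algebra.TensorProduct.tmul_mul_tmul, one_mul, mul_one,
    Algebra.algebraMap_self, RingHom.id_apply]

theorem prodMap_injective : Function.Injective (prodMap k C A) := by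
  have : (prodMap k C A).toLinearMap
      = (TensorProduct.AlgebraTensorModule.distribBaseChange k A C C).toLinearMap := by
    ext c c'
    simp [prodMap_tmul, TensorProduct.AlgebraTensorModule.distribBaseChange]
  intro x y h
  refine (TensorProduct.AlgebraTensorModule.distribBaseChange k A C C).injective ?_
  have hx := congrArg (fun l => l x) this
  have hy := congrArg (fun l => l y) this
  exact hx.symm.trans (h.trans hy)

theorem prodMap_comul (z : A ⊗[k] C) :
    prodMap k C A ((comul (R := k) (A := C)).lTensor A z) = comul (R := A) z := by
  induction z with
  | zero => simp
  | tmul a c =>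
    rw [LinearMap.lTensor_tmul, TensorProduct.comul_tmul]
    generalize (comul (R := k) c) = w
    induction w with
    | zero => simp
    | tmul x y =>
      have e : ∀ c : C, a ⊗ₜ[k] c = a • ((1 : A) ⊗ₜ[k] c) := fun c => by
        simp [TensorProduct.smul_tmul']
      simp [prodMap_tmul]
      rw [e x, e y, TensorProduct.smul_tmul]
    | add x y hx hy => simp only [TensorProduct.tmul_add, map_add, hx, hy]
  | add x y hx hy => simp only [map_add, hx, hy]

theorem prodMap_pairing (g : B →ₗ[k] A ⊗[k] C) (Φ : A ⊗[k] B →ₗ[A] A ⊗[k] C)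
    (h : ∀ f, Φ (1 ⊗ₜ f) = g f) (f : B) :
    prodMap k C A (pairing g f) = TensorProduct.map Φ Φ (comul (R := A) ((1 : A) ⊗ₜ[k] f)) := by
  have h1 : ∀ u v : A ⊗[k] C, prodMap k C A
      ((Algebra.TensorProduct.includeLeft : C →ₐ[k] C ⊗[k] C).toLinearMap.lTensor A u *
      (Algebra.TensorProduct.includeRight : C →ₐ[k] C ⊗[k] C).toLinearMap.lTensor A v)
      = u ⊗ₜ[A] v := by
    intro u v
    rw [map_mul]
    have hu : prodMap k C A
      ((Algebra.TensorProduct.includeLeft : C →ₐ[k] C ⊗[k] C).toLinearMap.lTensor A u)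
        = u ⊗ₜ[A] (1 : A ⊗[k] C) := by
      induction u with
      | zero => simp
      | tmul a c => simp [prodMap_tmul, Algebra.TensorProduct.one_def]
      | add x y hx hy => simp only [map_add, hx, hy, TensorProduct.add_tmul]
    have hv : prodMap k C A
      ((Algebra.TensorProduct.includeRight : C →ₐ[k] C ⊗[k] C).toLinearMap.lTensor A v)
        = (1 : A ⊗[k] C) ⊗ₜ[A] v := by
      induction v with
      | zero => simp
      | tmul a c =>
        have : a ⊗ₜ[k] c = a • ((1 : A) ⊗ₜ[k] c) := by simp [TensorProduct.smul_tmul']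
        rw [this, TensorProduct.tmul_smul, TensorProduct.smul_tmul']
        simp [prodMap_tmul, TensorProduct.smul_tmul', Algebra.TensorProduct.one_def]
      | add x y hx hy => simp only [map_add, hx, hy, TensorProduct.tmul_add]
    rw [hu, hv, Algebra.TensorProduct.tmul_mul_tmul, one_mul, mul_one]
  rw [TensorProduct.comul_tmul]
  simp only [pairing, LinearMap.comp_apply]
  generalize (comul (R := k) f) = w
  induction w with
  | zero => simp
  | tmul x y =>
    rw [TensorProduct.map_tmul, LinearMap.mul'_apply, LinearMap.comp_apply, LinearMap.comp_apply,
      h1]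
    simp [h]
  | add x y hx hy => simp only [TensorProduct.tmul_add, map_add, hx, hy]

theorem coef_counit (z : A ⊗[k] C) : coef (counit (R := k) (A := C)) z = counit (R := A) z := by
  induction z with
  | zero => simp
  | tmul a c => simp [coef_tmul]
  | add x y hx hy => simp only [map_add, hx, hy]

/-- The restriction to `B` of a homomorphism of `A`-bialgebras `A ⊗ B → A ⊗ C`. -/
def restr (μ : (A ⊗[k] B) →ₐc[A] (A ⊗[k] C)) : B →ₗ[k] A ⊗[k] C :=
  (((μ : (A ⊗[k] B) →ₐ[A] (A ⊗[k] C)).restrictScalars k).comp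
    Algebra.TensorProduct.includeRight).toLinearMap

theorem restr_apply (μ : (A ⊗[k] B) →ₐc[A] (A ⊗[k] C)) (f : B) :
    restr μ f = μ (1 ⊗ₜ f) := rfl

theorem isGroupHom_restr (μ : (A ⊗[k] B) →ₐc[A] (A ⊗[k] C)) : IsGroupHom (restr μ) where
  map_one := by
    rw [restr_apply]
    exact _root_.map_one μ
  map_mul f f' := by
    rw [restr_apply, restr_apply, restr_apply, ← _root_.map_mul,
      Algebra.TensorProduct.tmul_mul_tmul, one_mul]
  unit f := by
    rw [unitDefect, coef_counit, restr_apply, CoalgHomClass.counit_comp_apply]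
    simp [Algebra.algebraMap_eq_smul_one]
  mul f := by
    refine prodMap_injective ?_
    rw [mulDefect, map_sub, prodMap_comul, prodMap_pairing _ (μ : (A ⊗[k] B) →ₐ[A] (A ⊗[k] C)).toLinearMap
      (fun _ => rfl), map_zero, sub_eq_zero, restr_apply]
    exact (CoalgHomClass.map_comp_comul_apply μ _).symm

/-- The algebra map underlying a linear map satisfying `IsGroupHom`. -/
def IsGroupHom.toAlgHom {g : B →ₗ[k] A ⊗[k] C} (hg : IsGroupHom g) : B →ₐ[k] A ⊗[k] C :=
  AlgHom.ofLinearMap g hg.map_one hg.map_mul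

/-- The homomorphism of `A`-bialgebras `A ⊗ B → A ⊗ C` extending `g : B → A ⊗ C`. -/
def IsGroupHom.toBialgHom {g : B →ₗ[k] A ⊗[k] C} (hg : IsGroupHom g) :
    (A ⊗[k] B) →ₐc[A] (A ⊗[k] C) :=
  .ofAlgHom (Algebra.TensorProduct.lift (Algebra.ofId A _) hg.toAlgHom (fun _ _ => Commute.all _ _))
    (by
      refine Algebra.TensorProduct.ext (by ext) ?_
      apply AlgHom.ext
      intro f
      have := hg.unit f
      rw [unitDefect, coef_counit, sub_eq_zero] at this
      simpa [IsGroupHom.toAlgHom, Algebra.algebraMap_eq_smul_one] using this)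
    (by
      refine Algebra.TensorProduct.ext (by ext) ?_
      apply AlgHom.ext
      intro f
      have := hg.mul f
      rw [mulDefect, sub_eq_zero] at this
      have := congrArg (prodMap k C A) this
      rw [prodMap_comul, prodMap_pairing g
        (Algebra.TensorProduct.lift (Algebra.ofId A _) hg.toAlgHom
          (fun _ _ => Commute.all _ _)).toLinearMap
        (fun f => by simp [IsGroupHom.toAlgHom, ← Algebra.TensorProduct.one_def])] at this
      have h2 : (Algebra.TensorProduct.lift (Algebra.ofId A _) hg.toAlgHom
          (fun _ _ => Commute.all _ _) : A ⊗[k] B →ₐ[A] A ⊗[k] C) (1 ⊗ₜ f) = g f := by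
        simp [IsGroupHom.toAlgHom]
        rw [← Algebra.TensorProduct.one_def, one_mul]
      refine Eq.trans ?_ ((this.symm).trans ?_)
      · rfl
      · rw [← h2]; rfl)

theorem restr_toBialgHom {g : B →ₗ[k] A ⊗[k] C} (hg : IsGroupHom g) :
    restr hg.toBialgHom = g := by
  ext f
  simp [restr_apply, IsGroupHom.toBialgHom, IsGroupHom.toAlgHom]
  rw [← Algebra.TensorProduct.one_def, one_mul]

theorem restr_injective :
    Function.Injective (restr : ((A ⊗[k] B) →ₐc[A] (A ⊗[k] C)) → (B →ₗ[k] A ⊗[k] C)) := by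
  intro μ ν h
  apply BialgHom.coe_toAlgHom_injective
  refine Algebra.TensorProduct.ext (by ext) ?_
  apply AlgHom.ext
  intro f
  exact congrArg (fun l => l f) h

end Bridge

/-! ### The scheme `V(G)` of one-parameter subgroups -/

section OneParam

variable (k : Type*) [Field k] (p r : ℕ) [Fact p.Prime] [CharP k p]
  (B : Type*) [CommRing B] [HopfAlgebra k B]

/-- One-parameter subgroups of height `r`, over the `k`-algebra `A`, of the affine group scheme
`G = Spec B`: homomorphisms of group schemes over `A` from the base change of the `r`-th Frobenius
kernel of the additive group to the base change of `G`, given as homomorphisms of the Hopf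
algebras of functions. -/
abbrev OneParam (A : Type*) [CommRing A] [Algebra k A] : Type _ :=
  (A ⊗[k] B) →ₐc[A] (A ⊗[k] AddKernel k p r)

/-- The symmetric algebra on `p ^ r` copies of `B`; the element `ι (Pi.single i f)` is a variable
for the coefficient of `T ^ i` in the pullback of `f` to the additive kernel. -/
abbrev PreRing : Type _ := SymmetricAlgebra k (Fin (p ^ r) → B)

/-- The generic linear map `f ↦ ∑ i, x_{f, i} T ^ i`. -/
def generic : B →ₗ[k] PreRing k p r B ⊗[k] AddKernel k p r :=
  ∑ i : Fin (p ^ r), (TensorProduct.mk k (PreRing k p r B) (AddKernel k p r)).flip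
    (addT k p r ^ (i : ℕ)) ∘ₗ SymmetricAlgebra.ι k (Fin (p ^ r) → B) ∘ₗ LinearMap.single k (fun _ => B) i

/-- The equations saying that the generic linear map is an algebra map and defines a homomorphism
of group schemes. -/
def relations : Set (PreRing k p r B) :=
  {s | ∃ ψ : AddKernel k p r →ₗ[k] k, s = coef ψ (generic k p r B 1 - 1)} ∪
  {s | ∃ (ψ : AddKernel k p r →ₗ[k] k) (f f' : B), s = coef ψ
    (generic k p r B (f * f') - generic k p r B f * generic k p r B f')} ∪
  {s | ∃ f : B, s = unitDefect (generic k p r B) f} ∪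
  {s | ∃ (ψ : AddKernel k p r ⊗[k] AddKernel k p r →ₗ[k] k) (f : B),
    s = coef ψ (mulDefect (generic k p r B) f)}

/-- The coordinate algebra `k[V(G)]`, for `G = Spec B`: it represents the functor of one-parameter
subgroups of height `r`, see `oneParamEquiv`. -/
abbrev VRing : Type _ := PreRing k p r B ⧸ Ideal.span (relations k p r B)

variable {k p r B} {A A' : Type*} [CommRing A] [Algebra k A] [CommRing A'] [Algebra k A']

/-- The substitution of the coefficients of `g` for the variables. -/
def substitute (g : B →ₗ[k] A ⊗[k] AddKernel k p r) : PreRing k p r B →ₐ[k] A :=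
  SymmetricAlgebra.lift
    (∑ i : Fin (p ^ r), (coef (addCoeff k p r i) : A ⊗[k] AddKernel k p r →ₗ[A] A).restrictScalars k
      ∘ₗ g ∘ₗ LinearMap.proj i)

theorem sum_coef_tmul (z : A ⊗[k] AddKernel k p r) :
    ∑ i : Fin (p ^ r), coef (addCoeff k p r i) z ⊗ₜ[k] (addT k p r ^ (i : ℕ)) = z := by
  induction z with
  | zero => simp
  | tmul a c =>
    conv_rhs => rw [← sum_addCoeff k p r c, TensorProduct.tmul_sum]
    refine Finset.sum_congr rfl fun i _ => ?_
    rw [coef_tmul, TensorProduct.smul_tmul]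
  | add x y hx hy =>
    simp only [map_add, TensorProduct.add_tmul, Finset.sum_add_distrib, hx, hy]

theorem substitute_ι (g : B →ₗ[k] A ⊗[k] AddKernel k p r) (i : Fin (p ^ r)) (f : B) :
    substitute g (SymmetricAlgebra.ι k _ (Pi.single i f)) = coef (addCoeff k p r i) (g f) := by
  classical
  simp only [substitute, SymmetricAlgebra.lift_ι_apply, LinearMap.sum_apply, LinearMap.comp_apply,
    LinearMap.proj_apply, LinearMap.restrictScalars_apply]
  rw [Finset.sum_eq_single i]
  · simp
  · intro j _ hj
    simp [Pi.single_eq_of_ne hj]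
  · simp

theorem rTensor_substitute_generic (g : B →ₗ[k] A ⊗[k] AddKernel k p r) :
    (substitute g).toLinearMap.rTensor _ ∘ₗ generic k p r B = g := by
  apply LinearMap.ext
  intro f
  conv_rhs => rw [← sum_coef_tmul (g f)]
  simp only [generic, LinearMap.comp_apply, LinearMap.sum_apply, map_sum]
  refine Finset.sum_congr rfl fun i _ => ?_
  simp [substitute_ι]

theorem substitute_relations {g : B →ₗ[k] A ⊗[k] AddKernel k p r} (hg : IsGroupHom g)
    (s : PreRing k p r B) (hs : s ∈ Ideal.span (relations k p r B)) : substitute g s = 0 := by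
  have h : Ideal.span (relations k p r B) ≤ RingHom.ker (substitute g) := by
    refine Ideal.span_le.mpr ?_
    have e : ∀ f, (substitute g).toLinearMap.rTensor _ (generic k p r B f) = g f := fun f =>
      congrArg (fun l => l f) (rTensor_substitute_generic g)
    have e1 : (substitute g).toLinearMap.rTensor (AddKernel k p r) 1 = 1 :=
      map_one (Algebra.TensorProduct.map (substitute g) (AlgHom.id k (AddKernel k p r)))
    rintro s (((⟨ψ, rfl⟩ | ⟨ψ, f, f', rfl⟩) | ⟨f, rfl⟩) | ⟨ψ, f, rfl⟩)
    · change substitute g _ = 0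
      rw [← coef_rTensor, map_sub, e, e1, hg.map_one, sub_self, map_zero]
    · change substitute g _ = 0
      rw [← coef_rTensor, map_sub, rTensor_mul, e, e, e, hg.map_mul, sub_self, map_zero]
    · change substitute g _ = 0
      rw [← unitDefect_rTensor, rTensor_substitute_generic, hg.unit]
    · change substitute g _ = 0
      rw [← coef_rTensor, ← mulDefect_rTensor, rTensor_substitute_generic, hg.mul, map_zero]
  exact h hs

/-- The morphism `k[V(G)] → A` classifying a one-parameter subgroup over `A`. -/
def OneParam.classify (μ : OneParam k p r B A) : VRing k p r B →ₐ[k] A :=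
  Ideal.Quotient.liftₐ _ (substitute (restr μ)) (substitute_relations (isGroupHom_restr μ))

/-- The linear map underlying the one-parameter subgroup over `A` attached to `k[V(G)] → A`. -/
def specialize (φ : VRing k p r B →ₐ[k] A) : B →ₗ[k] A ⊗[k] AddKernel k p r :=
  (φ.comp (Ideal.Quotient.mkₐ k _)).toLinearMap.rTensor _ ∘ₗ generic k p r B

theorem isGroupHom_specialize (φ : VRing k p r B →ₐ[k] A) : IsGroupHom (specialize φ) := by
  set π := φ.comp (Ideal.Quotient.mkₐ k (Ideal.span (relations k p r B))) with hπ
  have h0 : ∀ s ∈ relations k p r B, π s = 0 := fun s hs => by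
    have : Ideal.Quotient.mk (Ideal.span (relations k p r B)) s = 0 :=
      Ideal.Quotient.eq_zero_iff_mem.mpr (Ideal.subset_span hs)
    simp [hπ, this]
  have e1 : π.toLinearMap.rTensor (AddKernel k p r) 1 = 1 :=
      map_one (Algebra.TensorProduct.map π (AlgHom.id k (AddKernel k p r)))
  refine ⟨?_, fun f f' => ?_, fun f => ?_, fun f => ?_⟩
  · rw [← sub_eq_zero]
    refine eq_zero_of_coef _ fun ψ => ?_
    have := h0 _ (Or.inl (Or.inl (Or.inl ⟨ψ, rfl⟩)))
    rwa [← coef_rTensor, map_sub, e1] at this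
  · rw [← sub_eq_zero]
    refine eq_zero_of_coef _ fun ψ => ?_
    have := h0 _ (Or.inl (Or.inl (Or.inr ⟨ψ, f, f', rfl⟩)))
    rwa [← coef_rTensor, map_sub, rTensor_mul] at this
  · have := h0 _ (Or.inl (Or.inr ⟨f, rfl⟩))
    rwa [← unitDefect_rTensor] at this
  · refine eq_zero_of_coef _ fun ψ => ?_
    have := h0 _ (Or.inr ⟨ψ, f, rfl⟩)
    rwa [← coef_rTensor, ← mulDefect_rTensor] at this

/-- The one-parameter subgroup over `A` given by an `A`-valued point `k[V(G)] → A` of `V(G)`. -/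
def OneParam.ofPoint (φ : VRing k p r B →ₐ[k] A) : OneParam k p r B A :=
  (isGroupHom_specialize φ).toBialgHom

variable (k p r B A) in
/-- `V(G)` represents the functor of one-parameter subgroups of height `r`. -/
def oneParamEquiv : OneParam k p r B A ≃ (VRing k p r B →ₐ[k] A) where
  toFun := OneParam.classify
  invFun := OneParam.ofPoint
  left_inv μ := by
    apply restr_injective
    rw [OneParam.ofPoint, restr_toBialgHom]
    have : μ.classify.comp (Ideal.Quotient.mkₐ k (Ideal.span (relations k p r B)))
        = substitute (restr μ) := rfl
    rw [specialize, this, rTensor_substitute_generic]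
  right_inv φ := by
    apply Ideal.Quotient.algHom_ext
    have : (OneParam.ofPoint φ).classify.comp
        (Ideal.Quotient.mkₐ k (Ideal.span (relations k p r B)))
        = substitute (restr (OneParam.ofPoint φ)) := rfl
    rw [this, OneParam.ofPoint, restr_toBialgHom]
    apply SymmetricAlgebra.algHom_ext
    refine LinearMap.pi_ext' fun i => LinearMap.ext fun f => ?_
    change substitute (specialize φ) (SymmetricAlgebra.ι k _ (Pi.single i f)) =
      φ.comp (Ideal.Quotient.mkₐ k _) (SymmetricAlgebra.ι k _ (Pi.single i f))
    rw [substitute_ι, specialize, LinearMap.comp_apply, coef_rTensor]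
    congr 1
    simp only [generic, LinearMap.sum_apply, map_sum]
    rw [Finset.sum_eq_single i]
    · simp [coef_tmul, addCoeff_addT_pow]
    · intro j _ hj
      simp [coef_tmul, addCoeff_addT_pow, Fin.val_inj, hj.symm]
    · simp

/-- The trivial one-parameter subgroup. -/
def OneParam.trivial (A : Type*) [CommRing A] [Algebra k A] : OneParam k p r B A :=
  (unitBialgHom A (A ⊗[k] AddKernel k p r)).comp (counitBialgHom A (A ⊗[k] B))

/-- The point of `V(G)` underlying a one-parameter subgroup over a field extension `K` of `k`. -/
def OneParam.point {K : Type*} [Field K] [Algebra k K] (μ : OneParam k p r B K) :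
    PrimeSpectrum (VRing k p r B) :=
  ⟨RingHom.ker μ.classify, RingHom.ker_isPrime _⟩

variable (k p r B) in
/-- The point `0` of `V(G)`: the trivial one-parameter subgroup. -/
def zeroPoint : PrimeSpectrum (VRing k p r B) := (OneParam.trivial k).point

/-- The residue field `k(v)`. -/
abbrev residueField (v : PrimeSpectrum (VRing k p r B)) : Type _ := v.asIdeal.ResidueField

/-- The one-parameter subgroup `μ_v`, defined over `k(v)`, of a point `v` of `V(G)`. -/
def OneParam.atPoint (v : PrimeSpectrum (VRing k p r B)) :
    OneParam k p r B (residueField v) :=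
  .ofPoint (IsScalarTower.toAlgHom k (VRing k p r B) (residueField v))

/-- The element `θ_μ = μ_*(u_{r-1})` of the group algebra `A G`, the `A`-linear dual of
`A ⊗ B`, where `u_{r-1}` is the functional which takes a function on the additive kernel to its
coefficient of `T ^ (p ^ (r - 1))`. -/
def OneParam.theta (μ : OneParam k p r B A) : Module.Dual A (A ⊗[k] B) :=
  (coef (addCoeff k p r (p ^ (r - 1)))) ∘ₗ (μ : (A ⊗[k] B) →ₐ[A] (A ⊗[k] AddKernel k p r)).toLinearMap

end OneParam

/-! ### Rational modules -/

section Modules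

variable (k : Type*) [Field k] (H : Type*) [CommRing H] [Bialgebra k H]
  (M : Type*) [AddCommGroup M] [Module k M]

/-- A structure of rational module, over the affine group scheme `Spec H`, on the vector space `M`:
a (right) comodule structure over the Hopf algebra `H`. -/
structure RationalModule where
  /-- The coaction. -/
  coact : M →ₗ[k] M ⊗[k] H
  coassoc : (TensorProduct.assoc k M H H).toLinearMap ∘ₗ coact.rTensor H ∘ₗ coact
    = (comul (R := k) (A := H)).lTensor M ∘ₗ coact
  counit_coact : (TensorProduct.rid k M).toLinearMap ∘ₗ
    (counit (R := k) (A := H)).lTensor M ∘ₗ coact = LinearMap.id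

variable {k H M}

/-- The restriction of a rational module to a closed subgroup scheme, or more generally along the
homomorphism of group schemes given by a bialgebra map `π`. -/
def RationalModule.restrict (σ : RationalModule k H M) {B : Type*} [CommRing B] [Bialgebra k B]
    (π : H →ₐc[k] B) : RationalModule k B M where
  coact := (π : H →ₗ[k] B).lTensor M ∘ₗ σ.coact
  coassoc := by
    have h := σ.coassoc
    have h1 : comul (R := k) (A := B) ∘ₗ (π : H →ₗ[k] B)
        = TensorProduct.map (π : H →ₗ[k] B) (π : H →ₗ[k] B) ∘ₗ comul (R := k) (A := H) :=
      (CoalgHomClass.map_comp_comul π).symm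
    have h2 : (TensorProduct.assoc k M B B).toLinearMap ∘ₗ
        (((π : H →ₗ[k] B).lTensor M ∘ₗ σ.coact).rTensor B) ∘ₗ (π : H →ₗ[k] B).lTensor M
        = (TensorProduct.map (π : H →ₗ[k] B) (π : H →ₗ[k] B)).lTensor M ∘ₗ
          (TensorProduct.assoc k M H H).toLinearMap ∘ₗ σ.coact.rTensor H := by
      refine TensorProduct.ext' fun m f => ?_
      simp only [LinearMap.comp_apply, LinearMap.lTensor_tmul, LinearMap.rTensor_tmul]
      generalize σ.coact m = w
      induction w with
      | zero => simp
      | tmul x y => simp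
      | add x y hx hy => simp only [TensorProduct.add_tmul, map_add, hx, hy]
    rw [← LinearMap.comp_assoc (σ.coact) _ (LinearMap.lTensor M (comul (R := k) (A := B))),
      ← LinearMap.lTensor_comp, h1, LinearMap.lTensor_comp, LinearMap.comp_assoc, ← h,
      ← LinearMap.comp_assoc, ← LinearMap.comp_assoc, LinearMap.comp_assoc _ _
        (TensorProduct.assoc k M B B).toLinearMap, h2]
    rfl
  counit_coact := by
    rw [← LinearMap.comp_assoc σ.coact, ← LinearMap.lTensor_comp]
    have h1 : counit (R := k) (A := B) ∘ₗ (π : H →ₗ[k] B) = counit (R := k) (A := H) :=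
      CoalgHomClass.counit_comp π
    rw [h1, σ.counit_coact]

/-- The restriction of a rational module to the `r`-th Frobenius kernel. -/
def RationalModule.restrictKernel {H : Type*} [CommRing H] [HopfAlgebra k H] (p r : ℕ)
    [Fact p.Prime] [CharP k p] (σ : RationalModule k H M) :
    RationalModule k (FrobeniusKernel k p r H) M :=
  σ.restrict (Bialgebra.Quotient.mkBialgHom (frobeniusIdeal k p r H))

/-- The action of an element `x` of the group algebra of `Spec B` over `A`, the `A`-linear dual of
`A ⊗ B`, on the base change `A ⊗ M` of a module `M`: it sends `1 ⊗ m` to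
`∑ x(1 ⊗ f_i) ⊗ m_i`, if the coaction sends `m` to `∑ m_i ⊗ f_i`. -/
def RationalModule.act (σ : RationalModule k H M) {A : Type*} [CommRing A] [Algebra k A]
    (x : Module.Dual A (A ⊗[k] H)) : A ⊗[k] M →ₗ[A] A ⊗[k] M :=
  LinearMap.liftBaseChange A ((TensorProduct.comm k M A).toLinearMap ∘ₗ
    ((x.restrictScalars k) ∘ₗ TensorProduct.mk k A H 1).lTensor M ∘ₗ σ.coact)

end Modules

/-! ### Non-maximal rank varieties -/

section Rank

variable {k : Type*} [Field k] {p r : ℕ} [Fact p.Prime] [CharP k p]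
  {B : Type*} [CommRing B] [HopfAlgebra k B] {M : Type*} [AddCommGroup M] [Module k M]

/-- The rank of `θ_v ^ j` on `M_{k(v)}`. -/
def jRank (σ : RationalModule k B M) (j : ℕ) (v : PrimeSpectrum (VRing k p r B)) : ℕ :=
  Module.finrank (residueField v) (LinearMap.range ((σ.act (OneParam.atPoint v).theta) ^ j))

/-- The non-maximal `j`-rank variety `V^j(G)_M`, for `G = Spec B`, as a subset of `V(G)`: the
points at which the rank of `θ_v ^ j` is not the largest one on `V(G)`, together with the
point `0`. -/
def nonMaximalRank (p r : ℕ) [Fact p.Prime] [CharP k p] (σ : RationalModule k B M) (j : ℕ) :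
    Set (PrimeSpectrum (VRing k p r B)) :=
  {v | ∃ w : PrimeSpectrum (VRing k p r B), jRank σ j v < jRank σ j w} ∪ {zeroPoint k p r B}

end Rank

/-! ### The adjoint action -/

section Adjoint

/-- Conjugation `h ↦ x * h * x⁻¹` on the affine group scheme `Spec C` over `A`, by the `A`-valued
point `x`, on the level of algebras of functions. The product and the inverse are taken in the
group of `C`-valued points, and the identity of `C` is the generic point `h`. -/
def conjAlgHom {A C : Type*} [CommRing A] [CommRing C] [HopfAlgebra A C] (x : C →ₐ[A] A) :
    C →ₐ[A] C :=
  (WithConv.toConv ((Algebra.ofId A C).comp x) * WithConv.toConv (AlgHom.id A C) *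
    (WithConv.toConv ((Algebra.ofId A C).comp x))⁻¹).ofConv

theorem conj_comul {A C : Type*} [CommRing A] [CommRing C] [HopfAlgebra A C] (x : C →ₐ[A] A) :
    (Algebra.TensorProduct.map (conjAlgHom x) (conjAlgHom x)).comp (comulAlgHom A C)
      = (comulAlgHom A C).comp (conjAlgHom x) := by
  have hinv : ∀ (D : Type _) [CommRing D] [HopfAlgebra A D] (h : C →ₐ[A] D) (f : WithConv (C →ₐ[A] C)),
      h.comp (f⁻¹).ofConv = ((WithConv.toConv (h.comp f.ofConv))⁻¹).ofConv := fun _ _ _ _ _ => rfl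
  set X : WithConv (C →ₐ[A] C ⊗[A] C) := WithConv.toConv ((Algebra.ofId A (C ⊗[A] C)).comp x) with hX
  let i1 : C →ₐ[A] C ⊗[A] C := Algebra.TensorProduct.includeLeft
  let i2 : C →ₐ[A] C ⊗[A] C := Algebra.TensorProduct.includeRight
  have hof : ∀ h : C →ₐ[A] C ⊗[A] C, WithConv.toConv (h.comp ((Algebra.ofId A C).comp x)) = X := by
    intro h
    rw [hX, ← AlgHom.comp_assoc]
    congr 2
    ext
  have key : ∀ h : C →ₐ[A] C ⊗[A] C, WithConv.toConv (h.comp (conjAlgHom x))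
      = X * WithConv.toConv h * X⁻¹ := by
    intro h
    rw [conjAlgHom, AlgHom.comp_convMul_distrib, WithConv.toConv_ofConv, WithConv.toConv_ofConv]
    rw [AlgHom.comp_convMul_distrib, hinv]
    simp [hof]
  have hmap : ∀ F : C →ₐ[A] C, WithConv.toConv
      ((Algebra.TensorProduct.map F F).comp (comulAlgHom A C))
      = WithConv.toConv (i1.comp F) * WithConv.toConv (i2.comp F) := by
    intro F
    rw [AlgHom.convMul_def]
    congr 1
    rw [← AlgHom.comp_assoc]
    congr 1
    ext <;> simp [i1, i2]
  have hΔ : WithConv.toConv (comulAlgHom A C) = WithConv.toConv i1 * WithConv.toConv i2 := by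
    have := hmap (AlgHom.id A C)
    simpa using this
  apply WithConv.toConv_injective
  rw [key, hmap, key, key, hΔ]
  have hc : X⁻¹ * X = 1 := inv_mul_cancel X
  simp only [mul_assoc]
  rw [← mul_assoc X⁻¹ X, hc, one_mul]

theorem conj_counit {A C : Type*} [CommRing A] [CommRing C] [HopfAlgebra A C] (x : C →ₐ[A] A) :
    (counitAlgHom A C).comp (conjAlgHom x) = counitAlgHom A C := by
  apply WithConv.toConv_injective
  have h1 : WithConv.toConv (counitAlgHom A C) = 1 := rfl
  rw [conjAlgHom, AlgHom.comp_convMul_distrib, WithConv.toConv_ofConv, WithConv.toConv_ofConv,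
    AlgHom.comp_convMul_distrib]
  have h2 : (counitAlgHom A C).comp (WithConv.ofConv
      (WithConv.toConv ((Algebra.ofId A C).comp x))⁻¹) =
      ((WithConv.toConv ((counitAlgHom A C).comp ((Algebra.ofId A C).comp x)))⁻¹).ofConv := rfl
  rw [h2]
  simp [h1]

/-- Conjugation by an `A`-valued point as a map of bialgebras. -/
def conj {A C : Type*} [CommRing A] [CommRing C] [HopfAlgebra A C] (x : C →ₐ[A] A) : C →ₐc[A] C :=
  .ofAlgHom (conjAlgHom x) (conj_counit x) (conj_comul x)

variable {k : Type*} [Field k] (p r : ℕ) [Fact p.Prime] [CharP k p]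
  {H : Type*} [CommRing H] [HopfAlgebra k H] {A : Type*} [CommRing A] [Algebra k A]

variable (k H A) in
/-- The inclusion over `A` of the `r`-th Frobenius kernel of `Spec H` into `Spec H`. -/
def kernelIncl : (A ⊗[k] H) →ₐc[A] (A ⊗[k] FrobeniusKernel k p r H) :=
  Bialgebra.TensorProduct.map (.id A A) (Bialgebra.Quotient.mkBialgHom (frobeniusIdeal k p r H))

theorem kernelIncl_surjective : Function.Surjective (kernelIncl k p r H A) := by
  intro z
  induction z with
  | zero => exact ⟨0, map_zero _⟩
  | tmul a f =>
    obtain ⟨f, rfl⟩ := Ideal.Quotient.mk_surjective f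
    exact ⟨a ⊗ₜ f, rfl⟩
  | add x y hx hy =>
    obtain ⟨x, rfl⟩ := hx
    obtain ⟨y, rfl⟩ := hy
    exact ⟨x + y, map_add _ _ _⟩

/-- An endomorphism of the base change of the group scheme `Spec H` to `A` restricts to the base
change of the Frobenius kernel. -/
def kernelAlgHom (F : (A ⊗[k] H) →ₐc[A] (A ⊗[k] H)) :
    (A ⊗[k] FrobeniusKernel k p r H) →ₐ[A] (A ⊗[k] FrobeniusKernel k p r H) :=
  Algebra.TensorProduct.lift (Algebra.ofId A _)
    (Ideal.Quotient.liftₐ _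
      ((((kernelIncl k p r H A).comp F : (A ⊗[k] H) →ₐ[A] (A ⊗[k] FrobeniusKernel k p r H)).restrictScalars
        k).comp Algebra.TensorProduct.includeRight)
      (fun _ hx => frobeniusIdeal_le_ker p r _ (fun f hf => by
        have h := map_mk_pow p r A (F ((1 : A) ⊗ₜ[k] f))
        rw [CoalgHomClass.counit_comp_apply, TensorProduct.counit_tmul, hf, zero_smul,
          zero_pow (pow_ne_zero _ (Fact.out : p.Prime).ne_zero), map_zero] at h
        exact h) hx))
    (fun _ _ => Commute.all _ _)

theorem kernelAlgHom_comp (F : (A ⊗[k] H) →ₐc[A] (A ⊗[k] H)) :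
    (kernelAlgHom p r F).comp (kernelIncl k p r H A : (A ⊗[k] H) →ₐ[A] (A ⊗[k] FrobeniusKernel k p r H))
      = (kernelIncl k p r H A : (A ⊗[k] H) →ₐ[A] (A ⊗[k] FrobeniusKernel k p r H)).comp
        (F : (A ⊗[k] H) →ₐ[A] (A ⊗[k] H)) := by
  refine Algebra.TensorProduct.ext (by ext) ?_
  apply AlgHom.ext
  intro f
  have h1 : (kernelIncl k p r H A) ((1 : A) ⊗ₜ[k] f) = 1 ⊗ₜ Ideal.Quotient.mk _ f := rfl
  change kernelAlgHom p r F (kernelIncl k p r H A ((1 : A) ⊗ₜ[k] f))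
    = kernelIncl k p r H A (F ((1 : A) ⊗ₜ[k] f))
  rw [h1, kernelAlgHom, Algebra.TensorProduct.lift_tmul, map_one, one_mul]
  rfl

/-- The restriction to the Frobenius kernel as a homomorphism of group schemes. -/
def kernelHom (F : (A ⊗[k] H) →ₐc[A] (A ⊗[k] H)) :
    (A ⊗[k] FrobeniusKernel k p r H) →ₐc[A] (A ⊗[k] FrobeniusKernel k p r H) :=
  .ofAlgHom (kernelAlgHom p r F)
    (by
      rw [← AlgHom.cancel_right (f := (kernelIncl k p r H A : (A ⊗[k] H) →ₐ[A] (A ⊗[k] FrobeniusKernel k p r H)))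
        (kernelIncl_surjective p r), AlgHom.comp_assoc, kernelAlgHom_comp, ← AlgHom.comp_assoc,
        BialgHom.counitAlgHom_comp, BialgHom.counitAlgHom_comp])
    (by
      rw [← AlgHom.cancel_right (f := (kernelIncl k p r H A : (A ⊗[k] H) →ₐ[A] (A ⊗[k] FrobeniusKernel k p r H)))
        (kernelIncl_surjective p r), AlgHom.comp_assoc, ← BialgHom.map_comp_comulAlgHom,
        ← AlgHom.comp_assoc, ← Algebra.TensorProduct.map_comp, kernelAlgHom_comp,
        AlgHom.comp_assoc, kernelAlgHom_comp, Algebra.TensorProduct.map_comp, AlgHom.comp_assoc, BialgHom.map_comp_comulAlgHom,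
        ← AlgHom.comp_assoc, BialgHom.map_comp_comulAlgHom, AlgHom.comp_assoc])

variable {p r}

/-- The adjoint action of an `A`-valued point `g` of the group scheme `Spec H` on its Frobenius
kernel over `A`. -/
def adjoint (g : H →ₐ[k] A) :
    (A ⊗[k] FrobeniusKernel k p r H) →ₐc[A] (A ⊗[k] FrobeniusKernel k p r H) :=
  kernelHom p r (conj (Algebra.TensorProduct.lift (AlgHom.id A A) g (fun _ _ => Commute.all _ _)))

/-- The action of an `A`-valued point `g` of the group scheme `Spec H` on the one-parameter
subgroups over `A` of its Frobenius kernel: composition with the adjoint action. -/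
def OneParam.translate (g : H →ₐ[k] A) (μ : OneParam k p r (FrobeniusKernel k p r H) A) :
    OneParam k p r (FrobeniusKernel k p r H) A :=
  BialgHom.comp μ (adjoint g)

end Adjoint

end OneParameter

end

open OneParameter

/-! Choose a basis of $M$. The coaction then becomes a matrix $c$ of functions on $\mathcal G$ which
is multiplicative on points. Restrict its entries to $G$ and apply the operator $\theta$ of the
universal one-parameter subgroup over $k[V(G)]$; this gives one matrix $\Theta$ over $k[V(G)]$ whose
image in $k(v)$ is the matrix of $\theta_v$, for every $v$ at once.

Closedness: the rank of $\theta_v^j$ is the rank of $\Theta^j$ at $v$ (`RationalModule.jRank_eq`).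
It is bounded by $\dim M$, so its maximum $d$ is attained, and the locus of rank less than $d$ is
cut out by the $d\times d$ minors of $\Theta^j$. The point $0$ is $k$-rational, hence closed.

Stability: the rank at a point can be computed from any one-parameter subgroup over a field $K$
lying above that point, since the rank of a matrix does not change under field extension
(`RationalModule.jRank_point`). Because $M$ is a module for all of $\mathcal G$, the matrices of
$\theta$ for $\mu$ and for $\gamma_g\circ\mu$ are conjugate by $c(g)$ (`map_conj_matrix`), so the
ranks agree. The point $0$ is treated apart: only trivial subgroups lie above it, and conjugation
fixes them. -/

noncomputable section

/-! ### Rank and minors of matrices. -/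

namespace Matrix

variable {m n K L : Type*} [Fintype m] [Fintype n] [Field K] [Field L]

theorem exists_linearIndependent_rows (A : Matrix m n K) {d : ℕ} (hd : d ≤ A.rank) :
    ∃ r : Fin d → m, LinearIndependent K (A.submatrix r id).row := by
  rw [A.rank_eq_finrank_span_row] at hd
  obtain ⟨f, hf, -, hli⟩ := Submodule.exists_fun_fin_finrank_span_eq K (Set.range A.row)
  choose r hr using hf
  refine ⟨fun i => r (Fin.castLE hd i), ?_⟩
  have h : (A.submatrix (fun i => r (Fin.castLE hd i)) id).row = f ∘ Fin.castLE hd :=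
    funext fun i => hr _
  rw [h]
  exact hli.comp _ (Fin.castLE_injective hd)

/-- The rank of a matrix over a field is at least `d` if and only if it has a nonzero minor of
size `d`. -/
theorem le_rank_iff_exists_minor (A : Matrix m n K) (d : ℕ) :
    d ≤ A.rank ↔ ∃ (r : Fin d → m) (c : Fin d → n), (A.submatrix r c).det ≠ 0 := by
  constructor
  · intro hd
    -- Choose $d$ independent rows, then $d$ independent columns of the resulting $d\times n$ matrix
    -- by passing to its transpose; hence `det_transpose` at the end.
    obtain ⟨r, hr⟩ := A.exists_linearIndependent_rows hd
    have hrank : d ≤ (A.submatrix r id)ᵀ.rank := by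
      rw [rank_transpose, hr.rank_matrix, Fintype.card_fin]
    obtain ⟨c, hc⟩ := exists_linearIndependent_rows _ hrank
    refine ⟨r, c, ?_⟩
    have h := linearIndependent_rows_iff_isUnit.mp hc
    rw [isUnit_iff_isUnit_det, isUnit_iff_ne_zero, ← det_transpose] at h
    exact h
  · rintro ⟨r, c, h⟩
    have h' := (A.rank_submatrix_le r c)
    rwa [rank_of_det_ne_zero h, Fintype.card_fin] at h'

/-- A homomorphism of fields is injective, so it neither kills nor creates nonzero minors. -/
theorem rank_map_ringHom (A : Matrix m n K) (φ : K →+* L) : (A.map φ).rank = A.rank := by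
  refine eq_of_forall_le_iff fun d => ?_
  simp only [le_rank_iff_exists_minor, submatrix_map, ← RingHom.mapMatrix_apply, ← RingHom.map_det,
    map_ne_zero]

end Matrix

/-- The locus where a matrix over a commutative ring has rank less than `d` is closed. -/
theorem PrimeSpectrum.isClosed_rank_lt {R m n : Type*} [CommRing R] [Fintype m] [Fintype n]
    (N : Matrix m n R) (d : ℕ) :
    IsClosed {v : PrimeSpectrum R |
      (N.map (algebraMap R v.asIdeal.ResidueField)).rank < d} := by
  -- A minor vanishes in the residue field exactly when it lies in the prime. Index maps that repeat
  -- or permute indices add only zero minors or minors equal up to sign.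
  have h : {v : PrimeSpectrum R | (N.map (algebraMap R v.asIdeal.ResidueField)).rank < d}
      = zeroLocus {x | ∃ (r : Fin d → m) (c : Fin d → n), x = (N.submatrix r c).det} := by
    ext v
    rw [Set.mem_ofPred_eq, ← not_le, Matrix.le_rank_iff_exists_minor]
    simp only [Matrix.submatrix_map, ← RingHom.mapMatrix_apply, ← RingHom.map_det, ne_eq,
      Ideal.algebraMap_residueField_eq_zero, not_exists, not_not, mem_zeroLocus]
    constructor
    · rintro h _ ⟨r, c, rfl⟩
      exact h r c
    · exact fun h r c => h ⟨r, c, rfl⟩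
  rw [h]
  exact isClosed_zeroLocus _

namespace OneParameter

/-! ### Matrix coefficients of a rational module. -/

section MatrixCoefficients

variable {k : Type*} [Field k] {H : Type*} [CommRing H] [Bialgebra k H]
  {M : Type*} [AddCommGroup M] [Module k M] {ι : Type*}

/-- The matrix coefficients of a rational module with respect to a basis. -/
def RationalModule.matrixCoeff (σ : RationalModule k H M) (b : Module.Basis ι k M) :
    Matrix ι ι H :=
  Matrix.of fun i l => TensorProduct.lid k H ((b.coord i).rTensor H (σ.coact (b l)))

variable [Fintype ι] (σ : RationalModule k H M) (b : Module.Basis ι k M)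

theorem sum_basis_tmul {N : Type*} [AddCommGroup N] [Module k N] (z : M ⊗[k] N) :
    ∑ i, b i ⊗ₜ[k] TensorProduct.lid k N ((b.coord i).rTensor N z) = z := by
  induction z with
  | zero => simp
  | tmul m n =>
    simp only [LinearMap.rTensor_tmul, TensorProduct.lid_tmul, ← TensorProduct.smul_tmul,
      ← TensorProduct.sum_tmul, Module.Basis.coord_apply, b.sum_repr]
  | add x y hx hy => simp only [map_add, TensorProduct.tmul_add, Finset.sum_add_distrib, hx, hy]

theorem coord_sum_basis_tmul [DecidableEq ι] {N : Type*} [AddCommGroup N] [Module k N] (f : ι → N)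
    (i : ι) :
    TensorProduct.lid k N ((b.coord i).rTensor N (∑ l, b l ⊗ₜ[k] f l)) = f i := by
  simp [map_sum, Finsupp.single_apply]

theorem RationalModule.coact_basis (l : ι) :
    σ.coact (b l) = ∑ i, b i ⊗ₜ[k] σ.matrixCoeff b i l :=
  (sum_basis_tmul b _).symm

/-- This is coassociativity evaluated on a basis vector, compared coordinate by coordinate. It says
that the coefficients form a multiplicative matrix. -/
theorem RationalModule.comul_matrixCoeff (i l : ι) :
    comul (R := k) (σ.matrixCoeff b i l)
      = ∑ m, σ.matrixCoeff b i m ⊗ₜ[k] σ.matrixCoeff b m l := by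
  classical
  have h := congrArg (fun φ => φ (b l)) σ.coassoc
  simp only [LinearMap.comp_apply, LinearEquiv.coe_coe, σ.coact_basis, map_sum,
    LinearMap.rTensor_tmul, LinearMap.lTensor_tmul, TensorProduct.sum_tmul,
    TensorProduct.assoc_tmul] at h
  -- Makes the sum over the outermost basis vector the outer one, so that its coordinate can be read
  -- off.
  rw [Finset.sum_comm] at h
  simp only [← TensorProduct.tmul_sum] at h
  have h' := congrArg (fun z => TensorProduct.lid k _ ((b.coord i).rTensor (H ⊗[k] H) z)) h
  simp only [coord_sum_basis_tmul] at h'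
  exact h'.symm

theorem RationalModule.counit_matrixCoeff [DecidableEq ι] (i l : ι) :
    counit (R := k) (σ.matrixCoeff b i l) = (1 : Matrix ι ι k) i l := by
  have h := congrArg (fun φ => b.repr (φ (b l)) i) σ.counit_coact
  simpa [σ.coact_basis, map_sum, Finsupp.single_apply, Matrix.one_apply, eq_comm] using h

/-- The matrix of the action of an element of the group algebra. -/
theorem RationalModule.toMatrix_act [DecidableEq ι] {A : Type*} [CommRing A] [Algebra k A]
    (x : Module.Dual A (A ⊗[k] H)) :
    LinearMap.toMatrix (b.baseChange A) (b.baseChange A) (σ.act x)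
      = (σ.matrixCoeff b).map fun f => x (1 ⊗ₜ f) := by
  ext i l
  rw [LinearMap.toMatrix_apply, Matrix.map_apply]
  simp [RationalModule.act, σ.coact_basis, map_sum, Finsupp.single_apply,
    Module.Basis.baseChange_repr_tmul]

theorem RationalModule.finrank_range_act_pow [DecidableEq ι] {K : Type*} [Field K] [Algebra k K]
    (x : Module.Dual K (K ⊗[k] H)) (j : ℕ) :
    Module.finrank K (LinearMap.range (σ.act x ^ j))
      = (((σ.matrixCoeff b).map fun f => x (1 ⊗ₜ f)) ^ j).rank := by
  rw [← σ.toMatrix_act b, LinearMap.toMatrix_pow,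
    Matrix.rank_eq_finrank_range_toLin _ (b.baseChange K) (b.baseChange K),
    Matrix.toLin_toMatrix]

omit [Fintype ι] in
theorem RationalModule.matrixCoeff_restrict {B : Type*} [CommRing B] [Bialgebra k B]
    (π : H →ₐc[k] B) : (σ.restrict π).matrixCoeff b = (σ.matrixCoeff b).map π := by
  classical
  ext i l
  simp only [RationalModule.matrixCoeff, RationalModule.restrict, Matrix.of_apply, Matrix.map_apply,
    LinearMap.comp_apply]
  generalize σ.coact (b l) = z
  induction z with
  | zero => simp
  | tmul x y => simp
  | add x y hx hy => simp only [map_add, hx, hy]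

end MatrixCoefficients

/-! ### Multiplicative matrices under convolution and conjugation. -/

section Convolution

variable {A C D : Type*} [CommRing A] [CommRing C] [CommRing D] [Algebra A D] {ι : Type*}
  [Fintype ι]

/-- A multiplicative matrix of functions on `Spec C` is multiplicative on points of `Spec C`. -/
theorem map_convMul_matrix [Bialgebra A C] (c : Matrix ι ι C)
    (hc : ∀ i l, comul (R := A) (c i l) = ∑ m, c i m ⊗ₜ[A] c m l) (F G : WithConv (C →ₐ[A] D)) :
    c.map (F * G).ofConv = c.map F.ofConv * c.map G.ofConv := by
  ext i l
  rw [Matrix.map_apply, Matrix.mul_apply]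
  change (F * G) (c i l) = _
  rw [AlgHom.convMul_apply, hc, map_sum]
  simp

omit [Fintype ι] in
theorem map_convOne_matrix [DecidableEq ι] [Bialgebra A C] (c : Matrix ι ι C)
    (hc : ∀ i l, counit (R := A) (c i l) = (1 : Matrix ι ι A) i l) :
    c.map (1 : WithConv (C →ₐ[A] D)).ofConv = 1 := by
  ext i l
  rw [Matrix.map_apply]
  change algebraMap A D (counit (c i l)) = _
  rw [hc, Matrix.one_apply, Matrix.one_apply]
  split_ifs <;> simp

/-- Conjugation by a point acts on a representation by conjugation of matrices. -/
theorem map_conj_matrix [DecidableEq ι] [HopfAlgebra A C] (c : Matrix ι ι C)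
    (hc : ∀ i l, comul (R := A) (c i l) = ∑ m, c i m ⊗ₜ[A] c m l)
    (hc1 : ∀ i l, counit (R := A) (c i l) = (1 : Matrix ι ι A) i l) (g : C →ₐ[A] A) :
    ∃ U : (Matrix ι ι A)ˣ, ∀ x : C →ₗ[A] A,
      c.map (fun f => x (conj g f)) = U * c.map x * (U⁻¹ : (Matrix ι ι A)ˣ) := by
  let g' : WithConv (C →ₐ[A] A) := WithConv.toConv g
  -- Inverse points of the group give inverse matrices; $U$ will be the value of $c$ at $g$.
  have hU (F G : WithConv (C →ₐ[A] A)) (h : F * G = 1) : c.map F.ofConv * c.map G.ofConv = 1 := by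
    rw [← map_convMul_matrix c hc, h, map_convOne_matrix c hc1]
  refine ⟨⟨c.map g'.ofConv, c.map (g'⁻¹).ofConv, hU _ _ (mul_inv_cancel _),
    hU _ _ (inv_mul_cancel _)⟩, fun x => ?_⟩
  -- The convolution inverse is precomposition with the antipode, so it commutes with extending
  -- scalars from $A$ to $C$.
  have hinv : (WithConv.toConv ((Algebra.ofId A C).comp g))⁻¹
      = WithConv.toConv ((Algebra.ofId A C).comp (g'⁻¹).ofConv) := rfl
  -- Multiplicativity applied to $g h g^{-1}$ with $h$ the generic point, at which the value of $c$
  -- is $c$ itself.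
  have h : c.map (conjAlgHom g) = (c.map g'.ofConv).map (algebraMap A C) * c
      * (c.map (g'⁻¹).ofConv).map (algebraMap A C) := by
    rw [conjAlgHom, map_convMul_matrix c hc, map_convMul_matrix c hc, hinv]
    congr 2
  ext i l
  have h' := congrArg x (congrFun (congrFun h i) l)
  refine h'.trans ?_
  simp only [Matrix.mul_apply, Matrix.map_apply, map_sum, Finset.sum_mul, Units.inv_mk]
  refine Finset.sum_congr rfl fun m _ => Finset.sum_congr rfl fun m' _ => ?_
  -- The functional `x` is only $A$-linear, but the outer factors are scalars from $A$ and can be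
  -- pulled out.
  rw [mul_comm, ← Algebra.smul_def, ← Algebra.smul_def, map_smul, map_smul, smul_eq_mul,
    smul_eq_mul, mul_comm]

end Convolution

/-! ### The universal operator and the rank function on $V(G)$. -/

section Rank

variable {k : Type*} [Field k] {p r : ℕ} [Fact p.Prime] [CharP k p]
  {B : Type*} [CommRing B] [HopfAlgebra k B]

variable (k p r B) in
/-- The action of the universal one-parameter subgroup on functions: `f ↦ θ (1 ⊗ f)`. -/
def universalTheta (f : B) : VRing k p r B :=
  (OneParam.ofPoint (AlgHom.id k (VRing k p r B))).theta (1 ⊗ₜ f)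

theorem OneParam.theta_ofPoint_eq_coef {A : Type*} [CommRing A] [Algebra k A]
    (φ : VRing k p r B →ₐ[k] A) (f : B) :
    (OneParam.ofPoint φ).theta (1 ⊗ₜ f)
      = coef (addCoeff k p r (p ^ (r - 1))) (specialize φ f) :=
  congrArg (fun g => coef (addCoeff k p r (p ^ (r - 1))) (g f))
    (restr_toBialgHom (isGroupHom_specialize φ))

theorem specialize_comp {A A' : Type*} [CommRing A] [Algebra k A] [CommRing A'] [Algebra k A']
    (φ : VRing k p r B →ₐ[k] A) (ψ : A →ₐ[k] A') :
    specialize (ψ.comp φ) = ψ.toLinearMap.rTensor _ ∘ₗ specialize φ := by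
  simp only [specialize, AlgHom.comp_toLinearMap, LinearMap.rTensor_comp, LinearMap.comp_assoc]

/-- Every one-parameter subgroup is a base change of the universal one, and taking a coefficient in
$T$ commutes with base change. -/
theorem OneParam.theta_ofPoint {A : Type*} [CommRing A] [Algebra k A] (φ : VRing k p r B →ₐ[k] A)
    (f : B) : (OneParam.ofPoint φ).theta (1 ⊗ₜ f) = φ (universalTheta k p r B f) := by
  rw [universalTheta, theta_ofPoint_eq_coef, theta_ofPoint_eq_coef, ← coef_rTensor,
    ← LinearMap.comp_apply, ← specialize_comp, AlgHom.comp_id]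

theorem OneParam.ofPoint_classify {A : Type*} [CommRing A] [Algebra k A] (μ : OneParam k p r B A) :
    OneParam.ofPoint μ.classify = μ :=
  (oneParamEquiv k p r B A).left_inv μ

theorem OneParam.theta_apply {A : Type*} [CommRing A] [Algebra k A] (μ : OneParam k p r B A)
    (f : B) : μ.theta (1 ⊗ₜ f) = μ.classify (universalTheta k p r B f) := by
  rw [← OneParam.theta_ofPoint, OneParam.ofPoint_classify]

variable {M : Type*} [AddCommGroup M] [Module k M] {ι : Type*} [Fintype ι] [DecidableEq ι]

/-- The matrix of the operator `θ` of the universal one-parameter subgroup. -/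
def RationalModule.universalMatrix (p r : ℕ) [Fact p.Prime] [CharP k p] (σ : RationalModule k B M)
    (b : Module.Basis ι k M) : Matrix ι ι (VRing k p r B) :=
  (σ.matrixCoeff b).map (universalTheta k p r B)

omit [Fintype ι] [DecidableEq ι] in
theorem RationalModule.matrixCoeff_map_theta (σ : RationalModule k B M) (b : Module.Basis ι k M)
    {A : Type*} [CommRing A] [Algebra k A] (μ : OneParam k p r B A) :
    ((σ.matrixCoeff b).map fun f => μ.theta (1 ⊗ₜ f))
      = (σ.universalMatrix p r b).map μ.classify := by
  ext i l
  exact μ.theta_apply _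

theorem RationalModule.jRank_eq (σ : RationalModule k B M) (b : Module.Basis ι k M) (j : ℕ)
    (v : PrimeSpectrum (VRing k p r B)) :
    jRank σ j v = ((σ.universalMatrix p r b ^ j).map
      (algebraMap (VRing k p r B) v.asIdeal.ResidueField)).rank := by
  rw [jRank, σ.finrank_range_act_pow b, Matrix.map_pow]
  congr 2
  ext i l
  exact OneParam.theta_ofPoint _ _

/-- The residue field at the point of $\mu$ embeds in $K$, and both matrices of $\theta$ come from
the universal one. This frees the rank from the choice of field of definition. -/
theorem RationalModule.jRank_point (σ : RationalModule k B M) (b : Module.Basis ι k M) (j : ℕ)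
    {K : Type*} [Field K] [Algebra k K] (μ : OneParam k p r B K) :
    jRank σ j μ.point = (((σ.matrixCoeff b).map fun f => μ.theta (1 ⊗ₜ f)) ^ j).rank := by
  -- The prime is the kernel of `μ.classify`, so elements outside it become nonzero, hence units, in
  -- $K$.
  let φ : μ.point.asIdeal.ResidueField →+* K :=
    Ideal.ResidueField.lift μ.point.asIdeal (μ.classify : VRing k p r B →+* K) le_rfl
      (fun x hx => by
        rw [Submonoid.mem_comap]
        exact (IsUnit.mk0 _ hx))
  rw [σ.jRank_eq b, ← Matrix.rank_map_ringHom _ φ, σ.matrixCoeff_map_theta b μ,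
    Matrix.map_map]
  have hφ : (φ ∘ algebraMap (VRing k p r B) μ.point.asIdeal.ResidueField)
      = (μ.classify : VRing k p r B →+* K) := by
    ext x
    exact Ideal.ResidueField.lift_algebraMap ..
  rw [hφ, Matrix.map_pow]
  rfl

theorem RationalModule.jRank_le (σ : RationalModule k B M) (b : Module.Basis ι k M) (j : ℕ)
    (v : PrimeSpectrum (VRing k p r B)) : jRank σ j v ≤ Fintype.card ι := by
  rw [σ.jRank_eq b]
  exact Matrix.rank_le_card_width _

/-- The trivial subgroup is defined over $k$, so its classifying map is onto $k$ and has maximal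
kernel. -/
theorem isClosed_zeroPoint : IsClosed {zeroPoint k p r B} := by
  rw [PrimeSpectrum.isClosed_singleton_iff_isMaximal]
  have hs : Function.Surjective (OneParam.trivial k : OneParam k p r B k).classify := fun a =>
    ⟨algebraMap k _ a, AlgHom.commutes _ a⟩
  exact RingHom.ker_isMaximal_of_surjective _ hs

theorem isClosed_nonMaximalRank [FiniteDimensional k M] (σ : RationalModule k B M) (j : ℕ) :
    IsClosed (nonMaximalRank p r σ j) := by
  refine IsClosed.union ?_ isClosed_zeroPoint
  let b := Module.finBasis k M
  -- The ranks are bounded by $\dim M$, so the maximum is attained. This one $w$ then serves as the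
  -- witness for all $v$.
  obtain ⟨w, hw⟩ : ∃ w : PrimeSpectrum (VRing k p r B), ∀ v, jRank σ j v ≤ jRank σ j w := by
    have hfin : (Set.range (jRank σ j : PrimeSpectrum (VRing k p r B) → ℕ)).Finite :=
      (Set.finite_Iic (Fintype.card (Fin (Module.finrank k M)))).subset
        (Set.range_subset_iff.mpr fun v => σ.jRank_le b j v)
    obtain ⟨_, ⟨w, rfl⟩, hw⟩ := hfin.exists_maximal ⟨_, Set.mem_range_self (zeroPoint k p r B)⟩
    exact ⟨w, fun v => (le_total _ _).elim id fun h => hw ⟨v, rfl⟩ h⟩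
  convert PrimeSpectrum.isClosed_rank_lt (σ.universalMatrix p r b ^ j) (jRank σ j w) using 1
  ext v
  rw [Set.mem_ofPred_eq, Set.mem_ofPred_eq, ← σ.jRank_eq b]
  exact ⟨fun ⟨w', h⟩ => h.trans_le (hw w'), fun h => ⟨w, h⟩⟩

/-! ### The trivial one-parameter subgroup and the point $0$. -/

theorem OneParam.trivial_apply {A : Type*} [CommRing A] [Algebra k A] (z : A ⊗[k] B) :
    (OneParam.trivial A : OneParam k p r B A) z
      = algebraMap A (A ⊗[k] AddKernel k p r) (counit (R := A) z) := rfl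

theorem specialize_classify {A : Type*} [CommRing A] [Algebra k A] (μ : OneParam k p r B A) :
    specialize μ.classify = restr μ := by
  conv_rhs => rw [← μ.ofPoint_classify]
  exact (restr_toBialgHom (isGroupHom_specialize μ.classify)).symm

theorem specialize_injective {A : Type*} [CommRing A] [Algebra k A] :
    Function.Injective (specialize : (VRing k p r B →ₐ[k] A) → _) := by
  intro φ ψ h
  apply (oneParamEquiv k p r B A).symm.injective
  apply restr_injective
  exact (restr_toBialgHom (isGroupHom_specialize φ)).trans
    (h.trans (restr_toBialgHom (isGroupHom_specialize ψ)).symm)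

theorem OneParam.classify_trivial {A : Type*} [CommRing A] [Algebra k A] :
    (OneParam.trivial A : OneParam k p r B A).classify
      = (Algebra.ofId k A).comp (OneParam.trivial k : OneParam k p r B k).classify := by
  apply specialize_injective
  rw [specialize_comp, specialize_classify, specialize_classify]
  apply LinearMap.ext
  intro f
  rw [LinearMap.comp_apply, restr_apply, restr_apply, OneParam.trivial_apply,
    OneParam.trivial_apply]
  simp [Algebra.algebraMap_eq_smul_one, Algebra.TensorProduct.one_def,
    TensorProduct.smul_tmul']

/-- A point of $V(G)$ in general lies below many subgroups over $K$. The point $0$ has residue field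
$k$, which has only one $k$-embedding in $K$, so here the point determines the subgroup. -/
theorem OneParam.point_eq_zeroPoint_iff {K : Type*} [Field K] [Algebra k K]
    (μ : OneParam k p r B K) : μ.point = zeroPoint k p r B ↔ μ = OneParam.trivial K := by
  constructor
  · intro h
    have hker : RingHom.ker μ.classify
        = RingHom.ker (OneParam.trivial k : OneParam k p r B k).classify :=
      congrArg PrimeSpectrum.asIdeal h
    apply (oneParamEquiv k p r B K).injective
    refine Eq.trans ?_ OneParam.classify_trivial.symm
    apply AlgHom.ext
    intro s
    -- Subtracting from `s` its value at $0$ gives an element of the common kernel; hence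
    -- `μ.classify` takes the same constant value on `s`.
    have hs : s - algebraMap k _ ((OneParam.trivial k : OneParam k p r B k).classify s)
        ∈ RingHom.ker μ.classify := by
      rw [hker, RingHom.mem_ker, map_sub, AlgHom.commutes]
      exact sub_self _
    rw [RingHom.mem_ker, map_sub, AlgHom.commutes, sub_eq_zero] at hs
    exact hs
  · rintro rfl
    apply PrimeSpectrum.ext
    change RingHom.ker (OneParam.trivial K : OneParam k p r B K).classify = RingHom.ker _
    rw [OneParam.classify_trivial]
    ext s
    simp only [RingHom.mem_ker, AlgHom.comp_apply, Algebra.ofId_apply, map_eq_zero]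

end Rank

/-! ### Effect of the adjoint action on $\theta$ and on ranks. -/

section Adjoint

variable {k : Type*} [Field k] {p r : ℕ} [Fact p.Prime] [CharP k p]
  {H : Type*} [CommRing H] [HopfAlgebra k H]

/-- The trivial subgroup factors through the counit, which every bialgebra map preserves. -/
theorem OneParam.translate_trivial {A : Type*} [CommRing A] [Algebra k A] (g : H →ₐ[k] A) :
    (OneParam.trivial A : OneParam k p r (FrobeniusKernel k p r H) A).translate g
      = OneParam.trivial A := by
  apply BialgHom.ext
  intro z
  change (OneParam.trivial A : OneParam k p r (FrobeniusKernel k p r H) A) (adjoint g z)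
    = (OneParam.trivial A : OneParam k p r (FrobeniusKernel k p r H) A) z
  rw [OneParam.trivial_apply, OneParam.trivial_apply, CoalgHomClass.counit_comp_apply]

/-- Since $g$ is a point of $\mathcal G$ and not of $G$, conjugation has to be computed on $\mathcal
G$; this carries the result over to the Frobenius kernel. -/
theorem adjoint_kernelIncl {A : Type*} [CommRing A] [Algebra k A] (g : H →ₐ[k] A)
    (z : A ⊗[k] H) :
    adjoint g (kernelIncl k p r H A z) = kernelIncl k p r H A (conj (Algebra.TensorProduct.lift
      (AlgHom.id A A) g (fun _ _ => Commute.all _ _)) z) :=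
  congrArg (fun φ => φ z) (kernelAlgHom_comp p r (conj (Algebra.TensorProduct.lift
    (AlgHom.id A A) g (fun _ _ => Commute.all _ _))))

variable {M : Type*} [AddCommGroup M] [Module k M] {ι : Type*} [Fintype ι] [DecidableEq ι]

omit [DecidableEq ι] in
theorem RationalModule.comul_baseChange_matrixCoeff (σ : RationalModule k H M)
    (b : Module.Basis ι k M) {A : Type*} [CommRing A] [Algebra k A] (i l : ι) :
    comul (R := A) ((1 : A) ⊗ₜ[k] σ.matrixCoeff b i l)
      = ∑ m, ((1 : A) ⊗ₜ[k] σ.matrixCoeff b i m) ⊗ₜ[A] ((1 : A) ⊗ₜ[k] σ.matrixCoeff b m l) := by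
  rw [TensorProduct.comul_tmul, σ.comul_matrixCoeff]
  simp [TensorProduct.tmul_sum]

/-- The operators `θ` of a one-parameter subgroup and of its translate are conjugate. -/
theorem RationalModule.exists_matrixCoeff_theta_translate (σ : RationalModule k H M)
    (b : Module.Basis ι k M) {A : Type*} [CommRing A] [Algebra k A] (g : H →ₐ[k] A)
    (μ : OneParam k p r (FrobeniusKernel k p r H) A) :
    ∃ U : (Matrix ι ι A)ˣ,
      (((σ.restrictKernel p r).matrixCoeff b).map fun f => (μ.translate g).theta (1 ⊗ₜ f))
        = U * (((σ.restrictKernel p r).matrixCoeff b).map fun f => μ.theta (1 ⊗ₜ f))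
          * (U⁻¹ : (Matrix ι ι A)ˣ) := by
  obtain ⟨U, hU⟩ := map_conj_matrix ((σ.matrixCoeff b).map fun f => (1 : A) ⊗ₜ[k] f)
    (σ.comul_baseChange_matrixCoeff b)
    (fun i l => by
      simp [σ.counit_matrixCoeff, Matrix.one_apply])
    (Algebra.TensorProduct.lift (AlgHom.id A A) g (fun _ _ => Commute.all _ _))
  refine ⟨U, ?_⟩
  -- Take the functional to be $\theta_\mu$ pushed forward to the group algebra of $\mathcal G$. The
  -- coefficients on $G$ are restrictions of those on $\mathcal G$, so this loses nothing.
  have h := hU (μ.theta ∘ₗ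
    (kernelIncl k p r H A : (A ⊗[k] H) →ₐ[A] (A ⊗[k] FrobeniusKernel k p r H)).toLinearMap)
  rw [Matrix.map_map, Matrix.map_map] at h
  rw [RationalModule.restrictKernel, σ.matrixCoeff_restrict, Matrix.map_map, Matrix.map_map]
  refine Eq.trans ?_ h
  ext i l
  exact congrArg μ.theta (adjoint_kernelIncl (p := p) (r := r) g (1 ⊗ₜ σ.matrixCoeff b i l))

/-- Conjugate matrices have conjugate $j$-th powers, and multiplying by invertible matrices
preserves rank. -/
theorem RationalModule.jRank_point_translate [FiniteDimensional k M] (σ : RationalModule k H M)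
    {K : Type*} [Field K] [Algebra k K] (g : H →ₐ[k] K)
    (μ : OneParam k p r (FrobeniusKernel k p r H) K) (j : ℕ) :
    jRank (σ.restrictKernel p r) j (μ.translate g).point
      = jRank (σ.restrictKernel p r) j μ.point := by
  let b := Module.finBasis k M
  obtain ⟨U, hU⟩ := σ.exists_matrixCoeff_theta_translate b g μ
  rw [RationalModule.jRank_point _ b, RationalModule.jRank_point _ b, hU, Units.conj_pow,
    Matrix.rank_mul_eq_left_of_isUnit_det _ _ ((Matrix.isUnit_iff_isUnit_det _).mp (U⁻¹).isUnit),
    Matrix.rank_mul_eq_right_of_isUnit_det _ _ ((Matrix.isUnit_iff_isUnit_det _).mp U.isUnit)]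

end Adjoint

end OneParameter

end

/-! ### The main theorem. -/

open OneParameter
theorem lemma5p11 {k : Type*} [Field k] {p : ℕ} [Fact p.Prime] [CharP k p]
    {H : Type*} [CommRing H] [HopfAlgebra k H] [Algebra.FiniteType k H]
    {M : Type*} [AddCommGroup M] [Module k M] [FiniteDimensional k M]
    (σ : RationalModule k H M) (r : ℕ) (hr : 1 ≤ r) (j : ℕ) (hj : 1 ≤ j) (hjp : j < p) :
    IsClosed (nonMaximalRank p r (σ.restrictKernel p r) j) ∧
      ∀ (K : Type*) [Field K] [Algebra k K] (g : H →ₐ[k] K)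
        (μ : OneParam k p r (FrobeniusKernel k p r H) K),
        μ.point ∈ nonMaximalRank p r (σ.restrictKernel p r) j →
          (μ.translate g).point ∈ nonMaximalRank p r (σ.restrictKernel p r) j := by
  refine ⟨isClosed_nonMaximalRank _ j, fun K _ _ g μ hμ => ?_⟩
  rcases hμ with ⟨w, hw⟩ | hμ
  -- The rank at the point of $\mu$ is unchanged by translation, so the same $w$ still exceeds it.
  · exact Or.inl ⟨w, by rwa [σ.jRank_point_translate]⟩
  · refine Or.inr ?_
    rw [Set.mem_singleton_iff, OneParam.point_eq_zeroPoint_iff] at hμ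
    rw [hμ, OneParam.translate_trivial]
    exact (OneParam.point_eq_zeroPoint_iff _).mpr rfl
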